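/- **Theorem 3.1.** Let $\beta_c=\sqrt{2\log 2}$, $\beta>\beta_c$ and $\delta>0$. On a probability space $(\Omega,\Sigma,\mathbb P)$ let there be given, for each $N$, a family $(X_\sigma)_{\sigma\in\{-1,+1\}^N}$ of i.i.d. standard Gaussian random variables (nothing is assumed on the joint law for different $N$). Let $H_N(\sigma)=\sqrt N\,X_\sigma$ be the energies of the random energy model, and for $\Psi:\{-1,+1\}^N\to\mathbb R$ let $$\mu_{N,\beta}(\Psi)=\frac{\sum_{\sigma}\Psi(\sigma)e^{-\beta H_N(\sigma)}}{\sum_{\sigma}e^{-\beta H_N(\sigma)}},\qquad \|\Psi\|_\infty=\max_\sigma|\Psi(\sigma)| .$$ Let $\tilde\sigma_1,\dots,\tilde\sigma_{2^N}$ be an enumeration of $\{-1,+1\}^N$ (depending on the sample) in order of nondecreasing energy, put $X_{i,2^N}=X_{\tilde\sigma_i}$, so that $X_{1,2^N}\le\dots\le X_{2^N,2^N}$ are the order statistics, and $$\varphi_N(i)=\exp\Bigl(-\tfrac{\beta}{\beta_c}\sqrt{2\log 2^N}\,\bigl(X_{i,2^N}-X_{1,2^N}\bigr)\Bigr).$$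 Let $(k_N)$ be a sequence of natural numbers with $$k_N\to\infty,\qquad \frac{k_N}{N}\to\infty,\qquad \frac{\log k_N}{N}\to 0\qquad (N\to\infty).$$ Then there exist events $\Omega_N\subset\Omega$ and an integer $N_0$ such that for all $N>N_0$ $$\mathbb P[\Omega_N]\ \ge\ 1-\frac{4}{(N\log 2)^{1+\delta}},$$ and on $\Omega_N$, for every such enumeration and every $\Psi:\{-1,+1\}^N\to\mathbb R$, $$\mu_{N,\beta}(\Psi)=\frac{\sum_{i=1}^{k_N}\Psi(\tilde\sigma_i)\,\varphi_N(i)+B_N(\Psi)}{\sum_{i=1}^{k_N}\varphi_N(i)+B_N(1)},\qquad B_N(\Psi):=\sum_{i=k_N+1}^{2^N}\Psi(\tilde\sigma_i)\,\varphi_N(i),$$ with $$|B_N(\Psi)|\ \le\ \frac{2\,\|\Psi\|_\infty}{\beta/\beta_c-1}\;\frac{1}{(k_N-1)^{(\beta/\beta_c-1)/2}} .$$ -/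

import Mathlib

open MeasureTheory ProbabilityTheory Filter Topology

noncomputable section

namespace REM

/-- The configuration space `{-1, +1}^N`; the two units of the integers are `1` and `-1`. -/
abbrev SpinConfig (N : ℕ) : Type := Fin N → ℤˣ

/-- The critical inverse temperature `√(2 log 2)`. -/
def criticalBeta : ℝ := √(2 * Real.log 2)

/-- The energies `√N · x_σ` for a realization `x` of the standard Gaussian variables. -/
def hamiltonian {N : ℕ} (x : SpinConfig N → ℝ) (σ : SpinConfig N) : ℝ := √(N : ℝ) * x σ

/-- The partition function `∑_σ exp (-β H(σ))`. -/
def partitionFunction {N : ℕ} (β : ℝ) (x : SpinConfig N → ℝ) : ℝ :=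
  ∑ σ, Real.exp (-β * hamiltonian x σ)

/-- The weight that the Gibbs measure gives to the configuration `σ`. -/
def gibbsWeight {N : ℕ} (β : ℝ) (x : SpinConfig N → ℝ) (σ : SpinConfig N) : ℝ :=
  Real.exp (-β * hamiltonian x σ) / partitionFunction β x

/-- The average of the observable `Ψ` under the Gibbs measure. -/
def gibbsAverage {N : ℕ} (β : ℝ) (x : SpinConfig N → ℝ) (Ψ : SpinConfig N → ℝ) : ℝ :=
  ∑ σ, Ψ σ * gibbsWeight β x σ

/-- `s` lists all the configurations in order of nondecreasing energy. The index is zero-based: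
`s i` is the configuration with the `(i+1)`-th lowest energy, and `x (s i)` is the `(i+1)`-th
order statistic of the sample `x`. -/
def IsEnergyOrdering {N : ℕ} (x : SpinConfig N → ℝ) (s : Fin (2 ^ N) ≃ SpinConfig N) : Prop :=
  Monotone fun i => x (s i)

/-- Every sample has an energy ordering. -/
theorem exists_isEnergyOrdering {N : ℕ} (x : SpinConfig N → ℝ) :
    ∃ s, IsEnergyOrdering x s := by
  have e : Fin (2 ^ N) ≃ SpinConfig N :=
    (Fintype.equivFinOfCardEq (by simp [SpinConfig])).symm
  exact ⟨(Tuple.sort fun i => x (e i)).trans e, Tuple.monotone_sort fun i => x (e i)⟩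

/-- The Boltzmann factor of the `(i+1)`-th lowest configuration, after subtraction of the minimum:
`exp (-(β/β_c) √(2 log 2^N) (X_{i+1,2^N} - X_{1,2^N}))`. -/
def shiftedFactor {N : ℕ} (β : ℝ) (x : SpinConfig N → ℝ) (s : Fin (2 ^ N) ≃ SpinConfig N)
    (i : Fin (2 ^ N)) : ℝ :=
  Real.exp (-(β / criticalBeta) * √(2 * Real.log (2 ^ N)) *
    (x (s i) - x (s ⟨0, Nat.two_pow_pos N⟩)))

/-- The sum of `Ψ` times the shifted Boltzmann factor over the `k` lowest configurations. -/
def lowSum {N : ℕ} (β : ℝ) (x : SpinConfig N → ℝ) (s : Fin (2 ^ N) ≃ SpinConfig N) (k : ℕ)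
    (Ψ : SpinConfig N → ℝ) : ℝ :=
  ∑ i with i.val < k, Ψ (s i) * shiftedFactor β x s i

/-- The error term: the same sum over all the configurations other than the `k` lowest ones. -/
def errorTerm {N : ℕ} (β : ℝ) (x : SpinConfig N → ℝ) (s : Fin (2 ^ N) ≃ SpinConfig N) (k : ℕ)
    (Ψ : SpinConfig N → ℝ) : ℝ :=
  ∑ i with k ≤ i.val, Ψ (s i) * shiftedFactor β x s i

end REM

end

namespace REM

/-! ### The standard Gaussian distribution function -/

/-! The Gibbs formula is algebra: the factor `exp (β H)` at the ground state cancels. The content is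
the tail bound. Let F be the Gaussian distribution function, M = 2^N, L = √(2 log M), b = β/β_c.
Choose quantiles M F(x₀) = l and M F(q i) = e⁻² i. By independence the minimum exceeds x₀ with
probability at most e^(-l), and a union bound over subsets gives i+1 values below q i with
probability at most e^(-(i+1)), summable over i ≥ k. By a Mills bound F grows at rate at most L+1
right of -L (`cdf_gaussian_le_mul_exp`), so the ratio of quantile levels becomes a gap: exp((L+1)(q
i - x₀)) ≥ e⁻² i / l (`exists_measureReal_le_and_gap`). With bL = (1+a)(L+1), the i-th factor is at
most (e² l / i)^(1+a), a convergent series (`abs_errorTerm_le`). Taking l of order log N, the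
prefactor costs only a small power of k - 1. -/

theorem cdf_gaussian_eq_integral (x : ℝ) :
    cdf (gaussianReal 0 1) x = ∫ t in Set.Iic x, gaussianPDFReal 0 1 t := by
  rw [cdf_eq_real, measureReal_def, gaussianReal_apply_eq_integral 0 one_ne_zero,
    ENNReal.toReal_ofReal]
  exact integral_nonneg fun t => gaussianPDFReal_nonneg 0 1 t

theorem continuous_gaussianPDFReal : Continuous (gaussianPDFReal 0 1) := by
  rw [gaussianPDFReal_def]; fun_prop

theorem hasDerivAt_gaussianPDFReal (x : ℝ) :
    HasDerivAt (gaussianPDFReal 0 1) (-x * gaussianPDFReal 0 1 x) x := by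
  have h : HasDerivAt (fun y : ℝ => -(y - 0) ^ 2 / (2 * ((1 : NNReal) : ℝ))) (-x) x := by
    have h1 : HasDerivAt (fun y : ℝ => -y ^ 2 / 2) (-(2 * x) / 2) x := by
      simpa using (hasDerivAt_pow 2 x).fun_neg.div_const 2
    convert h1 using 1
    · simp
    · ring
  rw [gaussianPDFReal_def]
  exact ((h.exp).const_mul (√(2 * Real.pi * ((1 : NNReal) : ℝ)))⁻¹).congr_deriv (by ring)

theorem hasDerivAt_cdf_gaussian (x : ℝ) :
    HasDerivAt (cdf (gaussianReal 0 1)) (gaussianPDFReal 0 1 x) x := by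
  have h : ⇑(cdf (gaussianReal 0 1)) = fun y => cdf (gaussianReal 0 1) 0 +
      ∫ t in (0 : ℝ)..y, gaussianPDFReal 0 1 t := by
    ext y
    have hi := integrable_gaussianPDFReal 0 1
    rw [cdf_gaussian_eq_integral, cdf_gaussian_eq_integral,
      ← intervalIntegral.integral_Iic_sub_Iic hi.integrableOn hi.integrableOn]
    ring
  rw [h]
  have hc := continuous_gaussianPDFReal
  exact (intervalIntegral.integral_hasDerivAt_right (hc.intervalIntegrable _ _)
    hc.stronglyMeasurable.stronglyMeasurableAtFilter hc.continuousAt).const_add _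

theorem gaussianPDFReal_le_one (x : ℝ) : gaussianPDFReal 0 1 x ≤ 1 := by
  rw [gaussianPDFReal]
  refine mul_le_one₀ (inv_le_one_of_one_le₀ ?_) (Real.exp_pos _).le ?_
  · rw [Real.one_le_sqrt]
    have := Real.pi_gt_three
    simp only [NNReal.coe_one]
    linarith
  · rw [Real.exp_le_one_iff]
    exact div_nonpos_of_nonpos_of_nonneg (by nlinarith [sq_nonneg (x - 0)]) (by positivity)

/-- A Mills ratio bound for the lower tail. -/
theorem gaussianPDFReal_le_mul_cdf_of_nonpos {x : ℝ} (hx : x ≤ 0) :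
    gaussianPDFReal 0 1 x ≤ (1 - x) * cdf (gaussianReal 0 1) x := by
  -- g is increasing on (-∞, 0], as 1 - y + y² ≤ (1 - y)² there, and g ≥ -1/(1 - y) → 0 at -∞.
  set g : ℝ → ℝ := fun y => cdf (gaussianReal 0 1) y - gaussianPDFReal 0 1 y / (1 - y) with hg
  have hd : ∀ y ≤ (0 : ℝ), HasDerivAt g (gaussianPDFReal 0 1 y -
      ((-y * gaussianPDFReal 0 1 y) * (1 - y) - gaussianPDFReal 0 1 y * (-1)) / (1 - y) ^ 2) y :=
    fun y hy => (hasDerivAt_cdf_gaussian y).sub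
      ((hasDerivAt_gaussianPDFReal y).div ((hasDerivAt_id y).const_sub 1) (by simp; linarith))
  have hm : MonotoneOn g (Set.Iic 0) := by
    refine monotoneOn_of_deriv_nonneg (convex_Iic 0)
      (fun y hy => (hd y hy).continuousAt.continuousWithinAt)
      (fun y hy => (hd y (interior_subset (s := Set.Iic (0 : ℝ)) hy)).differentiableAt.differentiableWithinAt)
      fun y hy => ?_
    have hy0 : y ≤ 0 := interior_subset (s := Set.Iic (0 : ℝ)) hy
    rw [(hd y hy0).deriv]
    have hp := gaussianPDFReal_nonneg 0 1 y
    rw [sub_nonneg, div_le_iff₀ (by nlinarith)]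
    nlinarith [mul_nonneg hp (neg_nonneg.2 hy0)]
  have hlim : Tendsto (fun y : ℝ => -(1 - y)⁻¹) atBot (𝓝 0) := by
    have h1 : Tendsto (fun y : ℝ => 1 - y) atBot atTop := by
      simpa [sub_eq_add_neg] using tendsto_atTop_add_const_left atBot (1 : ℝ) tendsto_neg_atBot_atTop
    simpa using (tendsto_inv_atTop_zero.comp h1).neg
  have h0 : 0 ≤ g x := by
    refine le_of_tendsto hlim ?_
    filter_upwards [Iic_mem_atBot x] with y hy
    have hy : y ≤ x := hy
    refine le_trans ?_ (hm (Set.mem_Iic.2 (hy.trans hx)) hx hy)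
    have h1 : 0 < 1 - y := by linarith
    have h2 : gaussianPDFReal 0 1 y / (1 - y) ≤ (1 - y)⁻¹ := by
      rw [div_eq_mul_inv]
      exact mul_le_of_le_one_left (inv_nonneg.2 h1.le) (gaussianPDFReal_le_one y)
    have := cdf_nonneg (gaussianReal 0 1) y
    simp only [hg]
    linarith
  have h1 : 0 < 1 - x := by linarith
  have h2 : gaussianPDFReal 0 1 x / (1 - x) ≤ cdf (gaussianReal 0 1) x := sub_nonneg.1 h0
  rw [div_le_iff₀ h1] at h2
  linarith

theorem gaussianPDFReal_le_mul_cdf {L x : ℝ} (hL : 0 ≤ L) (hx : -L ≤ x) :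
    gaussianPDFReal 0 1 x ≤ (L + 1) * cdf (gaussianReal 0 1) x := by
  rcases le_total x 0 with h | h
  · exact (gaussianPDFReal_le_mul_cdf_of_nonpos h).trans
      (mul_le_mul_of_nonneg_right (by linarith) (cdf_nonneg _ _))
  · have h1 : gaussianPDFReal 0 1 x ≤ gaussianPDFReal 0 1 0 := by
      simp only [gaussianPDFReal]
      gcongr
    have h2 := gaussianPDFReal_le_mul_cdf_of_nonpos le_rfl
    have h3 := monotone_cdf (gaussianReal 0 1) h
    nlinarith [cdf_nonneg (gaussianReal 0 1) x]

/-- To the right of `-L` the Gaussian distribution function grows at most at the exponential rate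
`L + 1`. -/
theorem cdf_gaussian_le_mul_exp {L x y : ℝ} (hL : 0 ≤ L) (hx : -L ≤ x) (hxy : x ≤ y) :
    cdf (gaussianReal 0 1) y ≤ cdf (gaussianReal 0 1) x * Real.exp ((L + 1) * (y - x)) := by
  -- Antitone right of -L, since the logarithmic derivative of F is at most L + 1 there.
  set g : ℝ → ℝ := fun t => cdf (gaussianReal 0 1) t * Real.exp (-(L + 1) * t)
  have hd : ∀ t, HasDerivAt g (gaussianPDFReal 0 1 t * Real.exp (-(L + 1) * t) +
      cdf (gaussianReal 0 1) t * (Real.exp (-(L + 1) * t) * (-(L + 1) * 1))) t := fun t =>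
    (hasDerivAt_cdf_gaussian t).mul (((hasDerivAt_id t).const_mul (-(L + 1))).exp)
  have hm : AntitoneOn g (Set.Ici (-L)) := by
    refine antitoneOn_of_deriv_nonpos (convex_Ici _)
      (fun t _ => (hd t).continuousAt.continuousWithinAt)
      (fun t _ => (hd t).differentiableAt.differentiableWithinAt) fun t ht => ?_
    rw [(hd t).deriv]
    have := gaussianPDFReal_le_mul_cdf hL (interior_subset ht : -L ≤ t)
    nlinarith [Real.exp_pos (-(L + 1) * t)]
  have h := hm hx (hx.trans hxy : -L ≤ y) hxy
  have h1 : cdf (gaussianReal 0 1) y = g y * Real.exp ((L + 1) * y) := by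
    simp only [g]
    rw [mul_assoc, ← Real.exp_add, ← add_mul, neg_add_cancel, zero_mul, Real.exp_zero, mul_one]
  rw [h1]
  refine (mul_le_mul_of_nonneg_right h (Real.exp_pos _).le).trans_eq ?_
  simp only [g]
  rw [mul_assoc, ← Real.exp_add]
  ring_nf

/-- Chernoff's bound with tilt -L. -/
theorem cdf_gaussian_neg_le {L : ℝ} (hL : 0 ≤ L) :
    cdf (gaussianReal 0 1) (-L) ≤ Real.exp (-L ^ 2 / 2) := by
  rw [cdf_eq_real]
  have h := measure_le_le_exp_mul_mgf (μ := gaussianReal 0 1) (X := id) (-L) (neg_nonpos.2 hL)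
    (integrable_exp_mul_gaussianReal (-L))
  refine h.trans_eq ?_
  rw [mgf_gaussianReal (by rw [Measure.map_id]), ← Real.exp_add]
  congr 1
  simp
  ring

theorem exists_cdf_gaussian_eq {p : ℝ} (h0 : 0 < p) (h1 : p < 1) :
    ∃ x, cdf (gaussianReal 0 1) x = p := by
  have hc : Continuous (cdf (gaussianReal 0 1)) :=
    continuous_iff_continuousAt.2 fun x => (hasDerivAt_cdf_gaussian x).continuousAt
  exact mem_range_of_exists_le_of_exists_ge hc
    (((tendsto_cdf_atBot _).eventually (gt_mem_nhds h0)).exists.imp fun _ => le_of_lt)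
    (((tendsto_cdf_atTop _).eventually (lt_mem_nhds h1)).exists.imp fun _ => le_of_lt)

/-! ### Deviation bounds for independent Gaussian families -/

section Deviation

variable {Ω ι : Type*} [MeasurableSpace Ω] [Fintype ι] {P : Measure Ω}
  {Y : ι → Ω → ℝ}

theorem measureReal_forall_lt (hlaw : ∀ i, HasLaw (Y i) (gaussianReal 0 1) P)
    (hindep : iIndepFun Y P) (x : ℝ) :
    P.real {ω | ∀ i, x < Y i ω} ≤
      Real.exp (-(Fintype.card ι * cdf (gaussianReal 0 1) x)) := by
  have h := hindep.measure_inter_preimage_eq_mul Finset.univ (sets := fun _ => Set.Ioi x)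
    (fun _ _ => measurableSet_Ioi)
  have hset : {ω | ∀ i, x < Y i ω} = ⋂ i ∈ Finset.univ, Y i ⁻¹' Set.Ioi x := by ext; simp
  have h1 : ∀ i, (P (Y i ⁻¹' Set.Ioi x)).toReal = 1 - cdf (gaussianReal 0 1) x := fun i => by
    have := (hlaw i).measureReal_eq (p := fun y => y ∈ Set.Ioi x) measurableSet_Ioi
    rw [cdf_eq_real, ← probReal_compl_eq_one_sub measurableSet_Iic, Set.compl_Iic]
    exact this
  rw [measureReal_def, hset, h, ENNReal.toReal_prod, Finset.prod_congr rfl fun i _ => h1 i,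
    Finset.prod_const, Finset.card_univ, ← mul_neg, Real.exp_nat_mul]
  exact pow_le_pow_left₀ (sub_nonneg.2 (cdf_le_one _ _)) (Real.one_sub_le_exp_neg _) _

/-- Union bound over the j-element subsets, with C(n, j) ≤ n^j / j!. -/
theorem measureReal_exists_card_forall_le (hlaw : ∀ i, HasLaw (Y i) (gaussianReal 0 1) P)
    (hindep : iIndepFun Y P) (j : ℕ) (x : ℝ) :
    P.real {ω | ∃ S : Finset ι, S.card = j ∧ ∀ i ∈ S, Y i ω ≤ x} ≤
      (Fintype.card ι * cdf (gaussianReal 0 1) x) ^ j / j.factorial := by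
  classical
  have hset : {ω | ∃ S : Finset ι, S.card = j ∧ ∀ i ∈ S, Y i ω ≤ x} =
      ⋃ S ∈ Finset.powersetCard j (Finset.univ : Finset ι), ⋂ i ∈ S, Y i ⁻¹' Set.Iic x := by
    ext; simp
  have h1 : ∀ S ∈ Finset.powersetCard j (Finset.univ : Finset ι),
      P.real (⋂ i ∈ S, Y i ⁻¹' Set.Iic x) = cdf (gaussianReal 0 1) x ^ j := fun S hS => by
    have h := hindep.measure_inter_preimage_eq_mul S (sets := fun _ => Set.Iic x)
      (fun _ _ => measurableSet_Iic)
    have h2 : ∀ i, (P (Y i ⁻¹' Set.Iic x)).toReal = cdf (gaussianReal 0 1) x := fun i => by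
      rw [cdf_eq_real]
      exact (hlaw i).measureReal_eq (p := fun y => y ∈ Set.Iic x) measurableSet_Iic
    rw [measureReal_def, h, ENNReal.toReal_prod, Finset.prod_congr rfl fun i _ => h2 i,
      Finset.prod_const, (Finset.mem_powersetCard.1 hS).2]
  rw [hset]
  refine (measureReal_biUnion_finset_le _ _).trans ?_
  rw [Finset.sum_congr rfl h1, Finset.sum_const, Finset.card_powersetCard, Finset.card_univ,
    nsmul_eq_mul, mul_pow, mul_div_right_comm]
  exact mul_le_mul_of_nonneg_right (Nat.choose_le_pow_div _ _) (pow_nonneg (cdf_nonneg _ _) _)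

/-- If a sample has on average `exp (-2) * i` values below `x`, then more than `i` of them are there
with probability at most `exp (-(i + 1))`. -/
theorem measureReal_exists_card_succ_le (hlaw : ∀ i, HasLaw (Y i) (gaussianReal 0 1) P)
    (hindep : iIndepFun Y P) (i : ℕ) {x : ℝ}
    (hx : Fintype.card ι * cdf (gaussianReal 0 1) x = Real.exp (-2) * i) :
    P.real {ω | ∃ S : Finset ι, S.card = i + 1 ∧ ∀ σ ∈ S, Y σ ω ≤ x} ≤
      Real.exp (-(i + 1 : ℕ)) := by
  refine (measureReal_exists_card_forall_le hlaw hindep (i + 1) x).trans ?_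
  rw [hx]
  -- The factorial costs e^(i+1); the constant e⁻² pays for it and leaves e^(-(i+1)).
  have h := Real.pow_div_factorial_le_exp ((i + 1 : ℕ) : ℝ) (by positivity) (i + 1)
  calc (Real.exp (-2) * i) ^ (i + 1) / (i + 1).factorial
      ≤ (Real.exp (-2) * (i + 1 : ℕ)) ^ (i + 1) / (i + 1).factorial := by
        gcongr; exact Nat.le_succ i
    _ = Real.exp (-2) ^ (i + 1) * ((i + 1 : ℕ) ^ (i + 1) / (i + 1).factorial) := by
        rw [mul_pow, mul_div_assoc]
    _ ≤ Real.exp (-2) ^ (i + 1) * Real.exp (i + 1 : ℕ) := by gcongr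
    _ = Real.exp (-(i + 1 : ℕ)) := by
        rw [← Real.exp_nat_mul, ← Real.exp_add]; congr 1; ring

end Deviation

/-! ### Tail sums by telescoping -/

theorem sum_Ico_exp_neg_succ_le (k n : ℕ) :
    ∑ i ∈ Finset.Ico k n, Real.exp (-(i + 1 : ℕ)) ≤ Real.exp (-k) := by
  rcases le_total n k with h | h
  · rw [Finset.Ico_eq_empty_of_le h]; exact (Real.exp_pos _).le
  · suffices h' : ∑ i ∈ Finset.Ico k n, Real.exp (-(i + 1 : ℕ)) ≤ Real.exp (-k) - Real.exp (-n) from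
      h'.trans (sub_le_self _ (Real.exp_pos _).le)
    induction n, h using Nat.le_induction with
    | base => simp
    | succ n h ih =>
      rw [Finset.sum_Ico_succ_top h]
      have h1 : Real.exp (-n) = Real.exp 1 * Real.exp (-(n + 1 : ℕ)) := by
        rw [← Real.exp_add]; congr 1; push_cast; ring
      have h2 : 2 ≤ Real.exp 1 := by linarith [Real.add_one_le_exp 1]
      nlinarith [Real.exp_pos (-(n + 1 : ℕ))]

/-- Bernoulli's inequality (1 - 1/x)^(-a) ≥ 1 + a/x; the right side telescopes along integers. -/
theorem rpow_neg_one_sub_le {a : ℝ} (ha : 0 < a) {x : ℝ} (hx : 1 < x) :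
    x ^ (-(1 + a)) ≤ ((x - 1) ^ (-a) - x ^ (-a)) / a := by
  have hx0 : 0 < x := by linarith
  have h1 : 0 < 1 - x⁻¹ := sub_pos.2 (inv_lt_one_of_one_lt₀ hx)
  have h2 : 1 + a * x⁻¹ ≤ (1 - x⁻¹) ^ (-a) := by
    rw [Real.rpow_def_of_pos h1]
    have h3 := Real.log_le_sub_one_of_pos h1
    have h4 := Real.add_one_le_exp (Real.log (1 - x⁻¹) * -a)
    nlinarith
  have h3 : (x - 1) ^ (-a) = x ^ (-a) * (1 - x⁻¹) ^ (-a) := by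
    rw [← Real.mul_rpow hx0.le h1.le, mul_sub, mul_inv_cancel₀ hx0.ne', mul_one]
  have h4 : x ^ (-(1 + a)) = x ^ (-a) * x⁻¹ := by
    rw [neg_add, Real.rpow_add hx0, Real.rpow_neg_one, mul_comm]
  rw [le_div_iff₀ ha, h3, h4]
  nlinarith [Real.rpow_pos_of_pos hx0 (-a)]

theorem sum_Ico_rpow_neg_le {a : ℝ} (ha : 0 < a) {k : ℕ} (hk : 2 ≤ k) (n : ℕ) :
    ∑ i ∈ Finset.Ico k n, (i : ℝ) ^ (-(1 + a)) ≤ ((k : ℝ) - 1) ^ (-a) / a := by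
  have hk1 : (1 : ℝ) < k := by exact_mod_cast hk
  rcases le_total n k with h | h
  · rw [Finset.Ico_eq_empty_of_le h]
    exact div_nonneg (Real.rpow_nonneg (by linarith) _) ha.le
  · suffices h' : ∑ i ∈ Finset.Ico k n, (i : ℝ) ^ (-(1 + a)) ≤
        (((k : ℝ) - 1) ^ (-a) - ((n : ℝ) - 1) ^ (-a)) / a by
      have hn : (k : ℝ) ≤ n := by exact_mod_cast h
      refine h'.trans ?_
      gcongr
      exact sub_le_self _ (Real.rpow_nonneg (by linarith) _)
    induction n, h using Nat.le_induction with
    | base => simp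
    | succ n h ih =>
      have hn : (k : ℝ) ≤ n := by exact_mod_cast h
      rw [Finset.sum_Ico_succ_top h]
      have h2 := rpow_neg_one_sub_le ha (hk1.trans_le hn)
      push_cast
      rw [add_sub_cancel_right]
      refine (add_le_add ih h2).trans_eq ?_
      ring

/-! ### The Gibbs average in terms of the shifted Boltzmann factors -/

theorem criticalBeta_pos : 0 < criticalBeta :=
  Real.sqrt_pos.2 (mul_pos two_pos (Real.log_pos one_lt_two))

theorem sqrt_two_mul_log_two_pow (N : ℕ) :
    √(2 * Real.log (2 ^ N)) = √(N : ℝ) * criticalBeta := by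
  rw [criticalBeta, ← Real.sqrt_mul (Nat.cast_nonneg N), Real.log_pow]
  ring_nf

/-- Since √(2 log 2^N) = √N β_c, the critical temperature drops out. -/
theorem shiftedFactor_eq {N : ℕ} (β : ℝ) (x : SpinConfig N → ℝ)
    (s : Fin (2 ^ N) ≃ SpinConfig N) (i : Fin (2 ^ N)) :
    shiftedFactor β x s i = Real.exp (-β * hamiltonian x (s i)) *
      Real.exp (β * hamiltonian x (s ⟨0, Nat.two_pow_pos N⟩)) := by
  have h := criticalBeta_pos.ne'
  rw [shiftedFactor, ← Real.exp_add, sqrt_two_mul_log_two_pow, hamiltonian, hamiltonian]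
  congr 1
  field_simp
  ring

theorem lowSum_add_errorTerm {N : ℕ} (β : ℝ) (x : SpinConfig N → ℝ)
    (s : Fin (2 ^ N) ≃ SpinConfig N) (k : ℕ) (Ψ : SpinConfig N → ℝ) :
    lowSum β x s k Ψ + errorTerm β x s k Ψ = (∑ σ, Ψ σ * Real.exp (-β * hamiltonian x σ)) *
      Real.exp (β * hamiltonian x (s ⟨0, Nat.two_pow_pos N⟩)) := by
  have h := Finset.sum_filter_add_sum_filter_not Finset.univ (fun i : Fin (2 ^ N) => i.val < k)
    (fun i => Ψ (s i) * shiftedFactor β x s i)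
  simp only [not_lt] at h
  rw [lowSum, errorTerm, h, ← s.sum_comp, Finset.sum_mul]
  exact Finset.sum_congr rfl fun i _ => by rw [shiftedFactor_eq, mul_assoc]

theorem gibbsAverage_eq {N : ℕ} (β : ℝ) (x : SpinConfig N → ℝ)
    (s : Fin (2 ^ N) ≃ SpinConfig N) (k : ℕ) (Ψ : SpinConfig N → ℝ) :
    gibbsAverage β x Ψ = (lowSum β x s k Ψ + errorTerm β x s k Ψ) /
      (lowSum β x s k (fun _ => 1) + errorTerm β x s k (fun _ => 1)) := by
  rw [lowSum_add_errorTerm, lowSum_add_errorTerm, mul_div_mul_right _ _ (Real.exp_pos _).ne',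
    gibbsAverage, Finset.sum_div]
  simp only [gibbsWeight, partitionFunction, mul_div_assoc, one_mul]

/-! ### The gaps between the order statistics -/

/-- Up to an exceptional set, the gaps between the smallest and the other order statistics of a
sample of `2 ^ N` standard Gaussian variables have logarithmic lower bounds. -/
theorem exists_measureReal_le_and_gap {Ω : Type*} [MeasurableSpace Ω] {P : Measure Ω}
    [IsProbabilityMeasure P] {N : ℕ} {X : SpinConfig N → Ω → ℝ}
    (hlaw : ∀ σ, HasLaw (X σ) (gaussianReal 0 1) P) (hindep : iIndepFun X P)
    {l : ℝ} (hl : 1 < l) (hlN : l < 2 ^ N) {k : ℕ} (hlk : l < Real.exp (-2) * k) :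
    ∃ B : Set Ω, P.real B ≤ Real.exp (-l) + Real.exp (-k) ∧
      ∀ ω ∉ B, ∀ s : Fin (2 ^ N) ≃ SpinConfig N, IsEnergyOrdering (fun σ => X σ ω) s →
        ∀ i : Fin (2 ^ N), k ≤ i.val →
          Real.exp (-2) * i / l ≤ Real.exp ((√(2 * Real.log (2 ^ N)) + 1) *
            (X (s i) ω - X (s ⟨0, Nat.two_pow_pos N⟩) ω)) := by
  set L := √(2 * Real.log (2 ^ N)) with hL
  have hM : (0 : ℝ) < 2 ^ N := by positivity
  have hcard : (Fintype.card (SpinConfig N) : ℝ) = 2 ^ N := by simp [SpinConfig]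
  have hl0 : 0 < l := by linarith
  have hk0 : 0 < k := by
    by_contra h
    obtain rfl : k = 0 := by omega
    simp at hlk
    linarith
  obtain ⟨x₀, hx₀⟩ := exists_cdf_gaussian_eq (div_pos hl0 hM) ((div_lt_one hM).2 hlN)
  -- Quantiles at e⁻² i expected points; outside the range the value is irrelevant.
  have hq : ∀ i : ℕ, ∃ q, i ∈ Finset.Ico k (2 ^ N) →
      cdf (gaussianReal 0 1) q = Real.exp (-2) * i / 2 ^ N := fun i => by
    by_cases hi : i ∈ Finset.Ico k (2 ^ N)
    · obtain ⟨h1, h2⟩ := Finset.mem_Ico.1 hi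
      have h2' : (i : ℝ) < 2 ^ N := by exact_mod_cast h2
      have h3 : (0 : ℝ) < i := by exact_mod_cast hk0.trans_le h1
      have he : Real.exp (-2) ≤ 1 := Real.exp_le_one_iff.2 (by norm_num)
      obtain ⟨q, hq⟩ := exists_cdf_gaussian_eq (p := Real.exp (-2) * i / 2 ^ N) (by positivity)
        ((div_lt_one hM).2 (by nlinarith))
      exact ⟨q, fun _ => hq⟩
    · exact ⟨0, fun h => absurd h hi⟩
  choose q hq using hq
  -- F(-L) ≤ e^(-L²/2) = 2^(-N) < l 2^(-N) = F(x₀), as l > 1.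
  have hLx : -L ≤ x₀ := by
    by_contra! h
    have h1 := (monotone_cdf (gaussianReal 0 1) h.le).trans
      (cdf_gaussian_neg_le (Real.sqrt_nonneg (2 * Real.log (2 ^ N))))
    have h2 : Real.exp (-L ^ 2 / 2) = 1 / 2 ^ N := by
      have hlog : 0 ≤ Real.log (2 ^ N) := Real.log_nonneg (one_le_pow₀ one_le_two)
      rw [hL, neg_div, Real.sq_sqrt (by positivity), mul_div_cancel_left₀ _ two_ne_zero,
        Real.exp_neg, Real.exp_log hM, one_div]
    rw [hx₀, h2, div_le_div_iff_of_pos_right hM] at h1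
    linarith
  refine ⟨{ω | ∀ σ, x₀ < X σ ω} ∪ ⋃ i ∈ Finset.Ico k (2 ^ N),
    {ω | ∃ S : Finset (SpinConfig N), S.card = i + 1 ∧ ∀ σ ∈ S, X σ ω ≤ q i}, ?_, ?_⟩
  · refine (measureReal_union_le _ _).trans (add_le_add ?_ ?_)
    · refine (measureReal_forall_lt hlaw hindep x₀).trans_eq ?_
      rw [hcard, hx₀, mul_div_cancel₀ _ hM.ne']
    · refine (measureReal_biUnion_finset_le _ _).trans
        ((Finset.sum_le_sum fun i hi => ?_).trans (sum_Ico_exp_neg_succ_le k (2 ^ N)))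
      refine measureReal_exists_card_succ_le hlaw hindep i ?_
      rw [hcard, hq i hi, mul_div_cancel₀ _ hM.ne']
  · intro ω hω s hs i hi
    have hmem : i.val ∈ Finset.Ico k (2 ^ N) := Finset.mem_Ico.2 ⟨hi, i.isLt⟩
    rw [Set.mem_union, not_or] at hω
    obtain ⟨h1, h2⟩ := hω
    simp only [Set.mem_ofPred_eq, not_forall, not_lt] at h1
    obtain ⟨σ, hσ⟩ := h1
    have h0 : X (s ⟨0, Nat.two_pow_pos N⟩) ω ≤ x₀ := by
      refine le_trans ?_ hσ
      have := hs (show (⟨0, Nat.two_pow_pos N⟩ : Fin (2 ^ N)) ≤ s.symm σ from Nat.zero_le _)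
      simpa using this
    have hqi : q i < X (s i) ω := by
      by_contra! hle
      -- Indices start at 0, so the configurations up to `s i` number i + 1.
      refine h2 (Set.mem_iUnion₂.2 ⟨i.val, hmem, (Finset.Iic i).map s.toEmbedding, by simp, ?_⟩)
      intro τ hτ
      obtain ⟨j, hj, rfl⟩ := Finset.mem_map.1 hτ
      exact (hs (Finset.mem_Iic.1 hj)).trans hle
    have hki : (k : ℝ) ≤ i.val := by exact_mod_cast hi
    -- The levels compare as l < e⁻² k ≤ e⁻² i.
    have hx₀q : x₀ ≤ q i := by
      by_contra! h
      have := monotone_cdf (gaussianReal 0 1) h.le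
      rw [hx₀, hq i hmem, div_le_div_iff_of_pos_right hM] at this
      have := mul_le_mul_of_nonneg_left hki (Real.exp_pos (-2)).le
      linarith
    have h := cdf_gaussian_le_mul_exp (Real.sqrt_nonneg _) hLx hx₀q
    rw [hx₀, hq i hmem, div_mul_eq_mul_div, div_le_div_iff_of_pos_right hM] at h
    rw [div_le_iff₀' hl0]
    refine h.trans ?_
    have : 0 ≤ L := Real.sqrt_nonneg _
    gcongr

/-! ### The bound on the error term -/

/-- `hab` rewrites the Boltzmann rate as a multiple of the rate L + 1 in `hgap`; the excess a > 0
makes the series summable. -/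
theorem abs_errorTerm_le {N : ℕ} {β : ℝ} {x : SpinConfig N → ℝ}
    {s : Fin (2 ^ N) ≃ SpinConfig N} {k : ℕ} (hk : 2 ≤ k) {l a : ℝ} (hl : 0 < l) (ha : 0 < a)
    (hab : β / criticalBeta * √(2 * Real.log (2 ^ N)) =
      (1 + a) * (√(2 * Real.log (2 ^ N)) + 1))
    (hgap : ∀ i : Fin (2 ^ N), k ≤ i.val → Real.exp (-2) * i / l ≤
      Real.exp ((√(2 * Real.log (2 ^ N)) + 1) * (x (s i) - x (s ⟨0, Nat.two_pow_pos N⟩))))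
    (Ψ : SpinConfig N → ℝ) :
    |errorTerm β x s k Ψ| ≤
      ‖Ψ‖ * ((Real.exp 2 * l) ^ (1 + a) * (((k : ℝ) - 1) ^ (-a) / a)) := by
  have hterm : ∀ i : Fin (2 ^ N), k ≤ i.val → |Ψ (s i) * shiftedFactor β x s i| ≤
      ‖Ψ‖ * ((Real.exp 2 * l) ^ (1 + a) * (i.val : ℝ) ^ (-(1 + a))) := fun i hi => by
    have hi0 : (0 : ℝ) < i.val := by exact_mod_cast (by omega : 0 < i.val)
    have hc : 0 < Real.exp (-2) * i / l := by positivity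
    rw [abs_mul]
    refine mul_le_mul (norm_le_pi_norm Ψ (s i)) ?_ (abs_nonneg _) (norm_nonneg _)
    have h := Real.rpow_le_rpow_of_nonpos hc (hgap i hi) (by linarith : -(1 + a) ≤ 0)
    rw [← Real.exp_mul] at h
    have h1 : |shiftedFactor β x s i| = Real.exp ((√(2 * Real.log (2 ^ N)) + 1) *
        (x (s i) - x (s ⟨0, Nat.two_pow_pos N⟩)) * -(1 + a)) := by
      rw [shiftedFactor, Real.abs_exp, neg_mul, hab]
      congr 1
      ring
    have h2 : (Real.exp (-2) * i / l) ^ (-(1 + a)) =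
        (Real.exp 2 * l) ^ (1 + a) * (i.val : ℝ) ^ (-(1 + a)) := by
      have : Real.exp (-2) * i / l = (Real.exp 2 * l)⁻¹ * i.val := by
        rw [mul_inv, ← Real.exp_neg]; ring
      rw [this, Real.mul_rpow (by positivity) hi0.le, Real.inv_rpow (by positivity),
        Real.rpow_neg (by positivity), inv_inv]
    rw [h1, ← h2]
    exact h
  rw [errorTerm]
  refine (Finset.abs_sum_le_sum_abs _ _).trans ?_
  refine (Finset.sum_le_sum fun i hi => hterm i (Finset.mem_filter.1 hi).2).trans ?_
  rw [← Finset.mul_sum, ← Finset.mul_sum]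
  gcongr
  refine le_trans (le_of_eq ?_) (sum_Ico_rpow_neg_le ha hk (2 ^ N))
  refine Finset.sum_bij (fun i _ => i.val) (fun i hi => ?_) (fun i _ j _ h => Fin.ext h)
    (fun j hj => ?_) fun i _ => rfl
  · exact Finset.mem_Ico.2 ⟨(Finset.mem_filter.1 hi).2, i.isLt⟩
  · obtain ⟨h1, h2⟩ := Finset.mem_Ico.1 hj
    exact ⟨⟨j, h2⟩, Finset.mem_filter.2 ⟨Finset.mem_univ _, h1⟩, rfl⟩

/-- Exponent budget: y^(-a) decays at least like y^(-3(b-1)/4), and c^(1+a) gives back at most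
y^((b-1)/4). -/
theorem rpow_mul_rpow_neg_div_le {b a c y : ℝ} (hb : 1 < b) (ha : 3 / 4 * (b - 1) ≤ a)
    (hab : 1 + a ≤ b) (hc : 1 ≤ c) (hy : 1 ≤ y) (hcy : c ≤ y ^ ((b - 1) / (4 * b))) :
    c ^ (1 + a) * (y ^ (-a) / a) ≤ 2 / (b - 1) * (1 / y ^ ((b - 1) / 2)) := by
  have hb1 : 0 < b - 1 := by linarith
  have ha0 : 0 < a := by linarith
  have hy0 : 0 < y := by linarith
  have h1 : c ^ (1 + a) ≤ y ^ ((b - 1) / 4) := calc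
    c ^ (1 + a) ≤ c ^ b := Real.rpow_le_rpow_of_exponent_le hc hab
    _ ≤ (y ^ ((b - 1) / (4 * b))) ^ b := Real.rpow_le_rpow (by linarith) hcy (by linarith)
    _ = y ^ ((b - 1) / 4) := by
      rw [← Real.rpow_mul hy0.le]; congr 1; field_simp
  have h2 : 1 / a ≤ 2 / (b - 1) := by
    rw [div_le_div_iff₀ ha0 hb1]; linarith
  calc c ^ (1 + a) * (y ^ (-a) / a)
      ≤ y ^ ((b - 1) / 4) * (y ^ (-a) / a) := by gcongr
    _ = y ^ ((b - 1) / 4 + -a) * (1 / a) := by rw [Real.rpow_add hy0]; ring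
    _ ≤ y ^ (-((b - 1) / 2)) * (2 / (b - 1)) := by
      refine mul_le_mul (Real.rpow_le_rpow_of_exponent_le hy ?_) h2 (by positivity) (by positivity)
      linarith
    _ = 2 / (b - 1) * (1 / y ^ ((b - 1) / 2)) := by rw [Real.rpow_neg hy0.le]; ring

theorem eventually_mul_log_mul_le_rpow (C : ℝ) {D r : ℝ} (hD : 0 < D) (hr : 0 < r) :
    ∀ᶠ N : ℕ in atTop, C * Real.log (N * D) ≤ (N : ℝ) ^ r := by
  have hN : Tendsto (fun N : ℕ => (N : ℝ) * D) atTop atTop :=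
    tendsto_natCast_atTop_atTop.atTop_mul_const hD
  have h := ((isLittleO_log_rpow_atTop hr).const_mul_left C).comp_tendsto hN
  have hc : 0 < (D ^ r)⁻¹ := by positivity
  filter_upwards [h.bound hc] with N h
  refine (le_abs_self _).trans (h.trans_eq ?_)
  simp only [Function.comp_apply, Real.norm_eq_abs]
  rw [abs_of_nonneg (by positivity), Real.mul_rpow (by positivity) hD.le]
  field_simp

end REM

/-! ### Choice of parameters and conclusion -/

theorem theorem3p1 {Ω : Type*} [MeasurableSpace Ω] (P : Measure Ω) [IsProbabilityMeasure P]
    (X : (N : ℕ) → REM.SpinConfig N → Ω → ℝ)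
    (hlaw : ∀ N σ, HasLaw (X N σ) (gaussianReal 0 1) P)
    (hindep : ∀ N, iIndepFun (X N) P)
    (β : ℝ) (hβ : REM.criticalBeta < β)
    (δ : ℝ) (hδ : 0 < δ)
    (k : ℕ → ℕ)
    (hk : Tendsto k atTop atTop)
    (hkN : Tendsto (fun N => (k N : ℝ) / N) atTop atTop)
    (hlogk : Tendsto (fun N => Real.log (k N) / N) atTop (𝓝 0)) :
    ∃ (ΩN : ℕ → Set Ω) (N₀ : ℕ), ∀ N > N₀,
      MeasurableSet (ΩN N) ∧
      1 - 4 / (N * Real.log 2) ^ (1 + δ) ≤ P.real (ΩN N) ∧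
      ∀ ω ∈ ΩN N, ∀ s : Fin (2 ^ N) ≃ REM.SpinConfig N,
        REM.IsEnergyOrdering (fun σ => X N σ ω) s →
        ∀ Ψ : REM.SpinConfig N → ℝ,
          REM.gibbsAverage β (fun σ => X N σ ω) Ψ =
            (REM.lowSum β (fun σ => X N σ ω) s (k N) Ψ +
                REM.errorTerm β (fun σ => X N σ ω) s (k N) Ψ) /
              (REM.lowSum β (fun σ => X N σ ω) s (k N) (fun _ => 1) +
                REM.errorTerm β (fun σ => X N σ ω) s (k N) (fun _ => 1)) ∧
          |REM.errorTerm β (fun σ => X N σ ω) s (k N) Ψ| ≤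
            2 * ‖Ψ‖ / (β / REM.criticalBeta - 1) *
              (1 / ((k N : ℝ) - 1) ^ ((β / REM.criticalBeta - 1) / 2)) := by
  have hβc := REM.criticalBeta_pos
  have hlog2 : 0 < Real.log 2 := Real.log_pos one_lt_two
  set b := β / REM.criticalBeta with hb
  have hb1 : 1 < b := (one_lt_div hβc).2 hβ
  -- Chosen so that e^(-l) = (N log 2)^(-(1+δ)).
  set l : ℕ → ℝ := fun N => (1 + δ) * Real.log (N * Real.log 2) with hl
  set L : ℕ → ℝ := fun N => √(2 * Real.log (2 ^ N)) with hL
  have hNlog : Tendsto (fun N : ℕ => (N : ℝ) * Real.log 2) atTop atTop :=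
    tendsto_natCast_atTop_atTop.atTop_mul_const hlog2
  have hlt : Tendsto l atTop atTop :=
    (Real.tendsto_log_atTop.comp hNlog).const_mul_atTop (by linarith)
  have hLt : Tendsto L atTop atTop := by
    have : L = fun N : ℕ => √(N : ℝ) * REM.criticalBeta :=
      funext REM.sqrt_two_mul_log_two_pow
    rw [this]
    exact (Real.tendsto_sqrt_atTop.comp tendsto_natCast_atTop_atTop).atTop_mul_const hβc
  have hr : 0 < (b - 1) / (4 * b) := div_pos (by linarith) (by linarith)
  have hexp : ∀ᶠ N : ℕ in atTop, 1 < N ∧ 1 < l N ∧ 4 * b / (b - 1) ≤ L N ∧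
      (N : ℝ) + 1 ≤ k N ∧ Real.exp 2 * l N ≤ N ∧
      Real.exp 2 * l N ≤ (N : ℝ) ^ ((b - 1) / (4 * b)) := by
    have h1 := REM.eventually_mul_log_mul_le_rpow (Real.exp 2 * (1 + δ)) hlog2 one_pos
    have h2 := REM.eventually_mul_log_mul_le_rpow (Real.exp 2 * (1 + δ)) hlog2 hr
    filter_upwards [eventually_gt_atTop 1, hlt.eventually_gt_atTop 1,
      hLt.eventually_ge_atTop (4 * b / (b - 1)), hkN.eventually_ge_atTop 2, h1, h2]
      with N hN hlN hLN hkN h1 h2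
    have hN' : (1 : ℝ) < N := by exact_mod_cast hN
    rw [Real.rpow_one, mul_assoc] at h1
    rw [mul_assoc] at h2
    rw [le_div_iff₀ (by linarith)] at hkN
    exact ⟨hN, hlN, hLN, by linarith, h1, h2⟩
  have hmain : ∀ᶠ N : ℕ in atTop, ∃ A : Set Ω, MeasurableSet A ∧
      1 - 4 / (N * Real.log 2) ^ (1 + δ) ≤ P.real A ∧
      ∀ ω ∈ A, ∀ s : Fin (2 ^ N) ≃ REM.SpinConfig N,
        REM.IsEnergyOrdering (fun σ => X N σ ω) s →
        ∀ Ψ : REM.SpinConfig N → ℝ,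
          |REM.errorTerm β (fun σ => X N σ ω) s (k N) Ψ| ≤
            2 * ‖Ψ‖ / (b - 1) * (1 / ((k N : ℝ) - 1) ^ ((b - 1) / 2)) := by
    filter_upwards [hexp] with N ⟨hN, hlN, hLN, hkN, h1, h2⟩
    have hN' : (1 : ℝ) < N := by exact_mod_cast hN
    have he : 1 ≤ Real.exp 2 := Real.one_le_exp two_pos.le
    have hl0 : 0 < l N := by linarith
    have hel : l N ≤ Real.exp 2 * l N := le_mul_of_one_le_left hl0.le he
    have hlM : l N < 2 ^ N := (hel.trans h1).trans_lt (by exact_mod_cast Nat.lt_two_pow_self)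
    have hlk : l N < Real.exp (-2) * k N := by
      rw [Real.exp_neg, lt_inv_mul_iff₀ (Real.exp_pos 2)]
      linarith
    obtain ⟨B, hB, hgap⟩ :=
      REM.exists_measureReal_le_and_gap (hlaw N) (hindep N) hlN hlM hlk
    have hNl : 0 < (N : ℝ) * Real.log 2 := by positivity
    have hel' : Real.exp (-l N) = 1 / (N * Real.log 2) ^ (1 + δ) := by
      rw [Real.exp_neg, Real.rpow_def_of_pos hNl, one_div, mul_comm (Real.log _)]
    have hek : Real.exp (-(k N : ℝ)) ≤ Real.exp (-l N) := Real.exp_le_exp.2 (by linarith)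
    -- B is not known to be measurable; its measurable hull has the same measure. As k ≥ l, that
    -- measure is at most 2e^(-l).
    refine ⟨(toMeasurable P B)ᶜ, (measurableSet_toMeasurable P B).compl, ?_, ?_⟩
    · rw [probReal_compl_eq_one_sub (measurableSet_toMeasurable P B), measureReal_def,
        measure_toMeasurable, ← measureReal_def]
      have h4 : 4 / ((N : ℝ) * Real.log 2) ^ (1 + δ) = 4 * Real.exp (-l N) := by
        rw [hel']; ring
      rw [h4]
      linarith [Real.exp_pos (-l N)]
    · intro ω hω s hs Ψ
      have hk2 : 2 ≤ k N := by
        have : (2 : ℝ) ≤ k N := by linarith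
        exact_mod_cast this
      have hL0 : 0 ≤ L N := Real.sqrt_nonneg _
      rw [div_le_iff₀ (by linarith)] at hLN
      obtain ⟨a, hab⟩ : ∃ a, b * L N = (1 + a) * (L N + 1) :=
        ⟨b * L N / (L N + 1) - 1, by field_simp; ring⟩
      -- Amounts to (b - 1)L ≥ 3b + 1, which follows from (b - 1)L ≥ 4b.
      have ha : 3 / 4 * (b - 1) ≤ a := by
        by_contra! h
        nlinarith
      have hab' : 1 + a ≤ b := by
        by_contra! h
        nlinarith
      have h5 := REM.abs_errorTerm_le (x := fun σ => X N σ ω) hk2 hl0 (by linarith : 0 < a) hab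
        (hgap ω (fun h => hω (subset_toMeasurable P B h)) s hs) Ψ
      have h6 := REM.rpow_mul_rpow_neg_div_le hb1 ha hab' (hlN.le.trans hel)
        (by linarith : 1 ≤ (k N : ℝ) - 1)
        (h2.trans (Real.rpow_le_rpow (by linarith) (by linarith) hr.le))
      refine h5.trans ((mul_le_mul_of_nonneg_left h6 (norm_nonneg Ψ)).trans_eq ?_)
      ring
  obtain ⟨N₀, hN₀⟩ := eventually_atTop.1 hmain
  choose! A hA using hN₀
  exact ⟨A, N₀, fun N hN => ⟨(hA N hN.le).1, (hA N hN.le).2.1, fun ω hω s hs Ψ =>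
    ⟨REM.gibbsAverage_eq β _ s (k N) Ψ, (hA N hN.le).2.2 ω hω s hs Ψ⟩⟩⟩
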